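/- Write $e(z)=\exp(2\pi i z)$. For every real $\tau\ge 1$ there exist a strictly increasing sequence of natural numbers $f(1)<f(2)<\cdots$ with $f(n)=O(n^{\tau})$ and a real constant $c>0$ such that the set $$ \mathcal G_{f,c}=\Bigl\{x\in[0,1]:\ \Bigl|\sum_{n=1}^{N}e\bigl(x f(n)\bigr)\Bigr|\ge cN\ \text{ for infinitely many } N\in\mathbb N\Bigr\} $$ has Hausdorff dimension $\dim \mathcal G_{f,c}=1-1/\tau$. -/

import Mathlib

/-- `e(z) = exp(2πiz)` for real `z`. -/
noncomputable def expTwoPiI (z : ℝ) : ℂ :=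
  Complex.exp (2 * (Real.pi : ℂ) * Complex.I * (z : ℂ))

/-- The exponential sum `V_f(x; N) = ∑_{n=1}^{N} e(x f(n))` of a real sequence `f(1), f(2), …`
(the value `f 0` is never used). -/
noncomputable def expSum (f : ℕ → ℝ) (x : ℝ) (N : ℕ) : ℂ :=
  ∑ n ∈ Finset.Icc 1 N, expTwoPiI (x * f n)

/-- The set of all `x ∈ [0, 1]` such that `|V_f(x; N)| ≥ c N` for infinitely many `N`. -/
def veryLargeSumSet (f : ℕ → ℝ) (c : ℝ) : Set ℝ :=
  {x | x ∈ Set.Icc (0 : ℝ) 1 ∧ {N : ℕ | c * (N : ℝ) ≤ ‖expSum f x N‖}.Infinite}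

/-!
The sequence is `f n = n * 2 ^ ⌊(τ - 1) * j⌋` for `2 ^ j ≤ n < 2 ^ (j + 1)` (`blockSeq`), which is
strictly increasing and at most `n ^ τ`; the constant is `c = 1 / 8`.

*Upper bound* (`dimH_veryLargeSumSet_le`). It holds for every strictly increasing `f` with
`f n ≤ C n ^ τ`. A sum over `n ≤ N` varies with `x` at the scale `N ^ (-τ)`, so the set where it is
at least `c N` is covered by cells of a grid of mesh `1 / Q`, `Q ≍ N ^ τ`, at whose left endpoints
the sum is still large. By the discrete Parseval identity (`sum_range_norm_expSum_sq`) there are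
only `O(Q / N)` such cells. After reducing to lengths `N = u * 2 ^ i` with bounded `u`
(`exists_dyadic_large`), the `d`-dimensional sum of the cover is a convergent geometric series as
soon as `d > 1 - 1 / τ`.

*Lower bound* (`le_dimH_veryLargeSumSet_blockSeq`). If the binary digits of `x` at the positions
`a + 1, …, a + j + 5`, with `a = ⌊(τ - 1) * j⌋`, all vanish, then `2 ^ a * x` is within
`2 ^ (-(j + 5))` of an integer, hence all terms of the block `2 ^ j ≤ n < 2 ^ (j + 1)` are close
to `1`, and one of the two sums ending just before and at the end of this block is large. Such `x`,
for infinitely many `j`, are obtained by moving the digit number `m` of an arbitrary `y ∈ [0, 1)`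
to the position `p m`, where `p` has extremely sparse gaps containing those windows (`gapPos`,
`exists_window_in_gap`). The windows end near `τ / (τ - 1)` times their starting position, so
`p m ≤ t m + O(1)` is possible for every `t > τ / (τ - 1)`. The map `y ↦ x` is monotone and has a
`1 / t`-Hölder inverse, so its image has dimension at least `1 / t` (`le_dimH_image_spread`); let
`t` tend to `τ / (τ - 1)`.
-/

open Filter Topology MeasureTheory ENNReal NNReal

/-! ### The character `e` and exponential sums -/

lemma expTwoPiI_eq (z : ℝ) :
    expTwoPiI z = Complex.exp (Complex.I * ((2 * Real.pi * z : ℝ) : ℂ)) := by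
  unfold expTwoPiI
  congr 1
  push_cast
  ring

lemma expTwoPiI_add (z w : ℝ) : expTwoPiI (z + w) = expTwoPiI z * expTwoPiI w := by
  unfold expTwoPiI
  rw [← Complex.exp_add]
  congr 1
  push_cast
  ring

@[simp] lemma expTwoPiI_zero : expTwoPiI 0 = 1 := by simp [expTwoPiI]

lemma expTwoPiI_eq_one_iff {z : ℝ} : expTwoPiI z = 1 ↔ ∃ n : ℤ, z = n := by
  unfold expTwoPiI
  rw [Complex.exp_eq_one_iff]
  refine exists_congr fun n => ?_
  have h : (2 * (Real.pi : ℂ) * Complex.I) ≠ 0 := by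
    simp [Real.pi_ne_zero]
  rw [mul_comm (n : ℂ), mul_right_inj' h]
  norm_cast

@[simp] lemma expTwoPiI_intCast (n : ℤ) : expTwoPiI n = 1 :=
  expTwoPiI_eq_one_iff.2 ⟨n, rfl⟩

@[simp] lemma norm_expTwoPiI (z : ℝ) : ‖expTwoPiI z‖ = 1 := by
  rw [expTwoPiI_eq, mul_comm, Complex.norm_exp_ofReal_mul_I]

lemma conj_expTwoPiI (z : ℝ) : (starRingEnd ℂ) (expTwoPiI z) = expTwoPiI (-z) := by
  rw [← Complex.inv_eq_conj (norm_expTwoPiI z)]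
  refine inv_eq_of_mul_eq_one_right ?_
  rw [← expTwoPiI_add]
  simp

lemma expTwoPiI_nat_mul (l : ℕ) (z : ℝ) : expTwoPiI (l * z) = expTwoPiI z ^ l := by
  unfold expTwoPiI
  rw [← Complex.exp_nat_mul]
  congr 1
  push_cast
  ring

lemma norm_expTwoPiI_sub_one_le (z : ℝ) : ‖expTwoPiI z - 1‖ ≤ 2 * Real.pi * |z| := by
  rw [expTwoPiI_eq]
  refine Real.norm_exp_I_mul_ofReal_sub_one_le.trans_eq ?_
  rw [Real.norm_eq_abs, abs_mul, abs_of_pos Real.two_pi_pos]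

lemma norm_expTwoPiI_sub_le (z w : ℝ) :
    ‖expTwoPiI z - expTwoPiI w‖ ≤ 2 * Real.pi * |z - w| := by
  have h : expTwoPiI z - expTwoPiI w = expTwoPiI w * (expTwoPiI (z - w) - 1) := by
    rw [mul_sub, ← expTwoPiI_add]
    simp
  rw [h, norm_mul, norm_expTwoPiI, one_mul]
  exact norm_expTwoPiI_sub_one_le _

lemma expSum_eq_add_sum_Ioc (f : ℕ → ℝ) (x : ℝ) {M N : ℕ} (h : M ≤ N) :
    expSum f x N = expSum f x M + ∑ n ∈ Finset.Ioc M N, expTwoPiI (x * f n) := by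
  have hIcc : ∀ K, Finset.Icc 1 K = Finset.Ioc 0 K := fun K => by ext; simp; omega
  unfold expSum
  rw [hIcc, hIcc, Finset.sum_Ioc_consecutive _ (Nat.zero_le _) h]

lemma norm_expSum_le_add (f : ℕ → ℝ) (x : ℝ) {M N : ℕ} (h : M ≤ N) :
    ‖expSum f x N‖ ≤ ‖expSum f x M‖ + ((N : ℝ) - M) := by
  rw [expSum_eq_add_sum_Ioc f x h]
  refine (norm_add_le _ _).trans (add_le_add_right ?_ _)
  refine (norm_sum_le _ _).trans ?_
  simp [Nat.cast_sub h]

lemma norm_expSum_sub_le {f : ℕ → ℕ} (hf : Monotone f) (x y : ℝ) (N : ℕ) :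
    ‖expSum (fun n => (f n : ℝ)) x N - expSum (fun n => (f n : ℝ)) y N‖
      ≤ 2 * Real.pi * |x - y| * f N * N := by
  unfold expSum
  rw [← Finset.sum_sub_distrib]
  have h : ∀ n ∈ Finset.Icc 1 N, ‖expTwoPiI (x * (f n : ℝ)) - expTwoPiI (y * (f n : ℝ))‖
      ≤ 2 * Real.pi * |x - y| * f N := by
    intro n hn
    refine (norm_expTwoPiI_sub_le _ _).trans ?_
    rw [← sub_mul, abs_mul, Nat.abs_cast, mul_assoc _ |x - y|]
    have : (f n : ℝ) ≤ f N := by exact_mod_cast hf (Finset.mem_Icc.1 hn).2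
    have := Real.pi_pos
    gcongr
  refine (norm_sum_le_of_le _ h).trans_eq ?_
  simp
  ring

/-- Orthogonality of the additive characters of `ℤ/Qℤ`. -/
lemma sum_range_expTwoPiI_div_mul {Q : ℕ} {k : ℤ} (hk : ¬ (Q : ℤ) ∣ k) :
    ∑ l ∈ Finset.range Q, expTwoPiI ((l : ℝ) / Q * k) = 0 := by
  rcases Nat.eq_zero_or_pos Q with rfl | hQ
  · simp
  have hQ' : (Q : ℝ) ≠ 0 := by positivity
  have h1 : ∀ l : ℕ, expTwoPiI ((l : ℝ) / Q * k) = expTwoPiI (k / Q) ^ l := fun l => by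
    rw [← expTwoPiI_nat_mul]
    congr 1
    ring
  simp_rw [h1]
  have hne : expTwoPiI ((k : ℝ) / Q) - 1 ≠ 0 := by
    rw [sub_ne_zero, Ne, expTwoPiI_eq_one_iff]
    rintro ⟨n, hn⟩
    rw [div_eq_iff hQ'] at hn
    exact hk ⟨n, by rw [mul_comm]; exact_mod_cast hn⟩
  refine mul_left_cancel₀ hne ?_
  rw [mul_geom_sum, ← expTwoPiI_nat_mul, mul_div_cancel₀ _ hQ']
  simp

/-- Discrete Parseval identity: the frequencies `f 1, …, f N` are distinct modulo `Q`, so the mean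
square of the exponential sum over the points `l / Q` is `N`. -/
lemma sum_range_norm_expSum_sq {f : ℕ → ℕ} (hf : StrictMono f) {N Q : ℕ} (hQ : f N < Q) :
    ∑ l ∈ Finset.range Q, ‖expSum (fun n => (f n : ℝ)) ((l : ℝ) / Q) N‖ ^ 2 = (Q : ℝ) * N := by
  have key : ∑ l ∈ Finset.range Q, ((‖expSum (fun n => (f n : ℝ)) ((l : ℝ) / Q) N‖ ^ 2 : ℝ) : ℂ)
      = (Q : ℂ) * N := by
    have h1 : ∀ l ∈ Finset.range Q,
        ((‖expSum (fun n => (f n : ℝ)) ((l : ℝ) / Q) N‖ ^ 2 : ℝ) : ℂ)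
        = ∑ n ∈ Finset.Icc 1 N, ∑ m ∈ Finset.Icc 1 N,
            expTwoPiI ((l : ℝ) / Q * (((f n : ℤ) - (f m : ℤ) : ℤ) : ℝ)) := by
      intro l _
      rw [Complex.ofReal_pow, ← Complex.mul_conj']
      unfold expSum
      rw [map_sum, Finset.sum_mul_sum]
      refine Finset.sum_congr rfl fun n _ => Finset.sum_congr rfl fun m _ => ?_
      rw [conj_expTwoPiI, ← expTwoPiI_add]
      congr 1
      push_cast
      ring
    rw [Finset.sum_congr rfl h1, Finset.sum_comm]
    have h2 : ∀ n ∈ Finset.Icc 1 N, ∑ l ∈ Finset.range Q, ∑ m ∈ Finset.Icc 1 N,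
        expTwoPiI ((l : ℝ) / Q * (((f n : ℤ) - (f m : ℤ) : ℤ) : ℝ)) = (Q : ℂ) := by
      intro n hn
      rw [Finset.sum_comm, Finset.sum_eq_single n]
      · simp
      · intro m hm hmn
        apply sum_range_expTwoPiI_div_mul
        intro hdvd
        have hn' := (hf.monotone (Finset.mem_Icc.1 hn).2).trans_lt hQ
        have hm' := (hf.monotone (Finset.mem_Icc.1 hm).2).trans_lt hQ
        have h0 : (f n : ℤ) - f m = 0 :=
          Int.eq_zero_of_abs_lt_dvd hdvd (by rw [abs_lt]; constructor <;> omega)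
        exact hmn (hf.injective (by omega))
      · exact fun h => absurd hn h
    rw [Finset.sum_congr rfl h2]
    simp [mul_comm]
  exact_mod_cast key

lemma card_filter_le_norm_expSum {f : ℕ → ℕ} (hf : StrictMono f) {N Q : ℕ} (hN : 0 < N)
    (hQ : f N < Q) {a : ℝ} (ha : 0 < a) :
    (((Finset.range Q).filter
      (fun l : ℕ => a * N ≤ ‖expSum (fun n => (f n : ℝ)) ((l : ℝ) / Q) N‖)).card : ℝ)
      ≤ Q / (a ^ 2 * N) := by
  set G := (Finset.range Q).filter
      (fun l : ℕ => a * N ≤ ‖expSum (fun n => (f n : ℝ)) ((l : ℝ) / Q) N‖) with hG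
  have hN' : (0 : ℝ) < N := by exact_mod_cast hN
  have h1 : (G.card : ℝ) * (a * N) ^ 2 ≤ (Q : ℝ) * N := by
    rw [← sum_range_norm_expSum_sq hf hQ, ← nsmul_eq_mul]
    refine (Finset.card_nsmul_le_sum G _ _ fun l hl => ?_).trans
      (Finset.sum_le_sum_of_subset_of_nonneg (Finset.filter_subset _ _) fun _ _ _ => by positivity)
    exact pow_le_pow_left₀ (by positivity) (Finset.mem_filter.1 hl).2 2
  rw [le_div_iff₀ (by positivity)]
  refine le_of_mul_le_mul_right ?_ hN'
  calc (G.card : ℝ) * (a ^ 2 * N) * N = G.card * (a * N) ^ 2 := by ring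
    _ ≤ _ := h1

/-! ### The upper bound for the dimension -/

/-- A convergence half of Borel–Cantelli for Hausdorff dimension: `s` is contained in the limsup of
unions of `#(G i)` grid intervals of length `1 / Q i`. -/
lemma dimH_le_of_grid_cover {s : Set ℝ} {d : ℝ≥0} {Q : ℕ → ℕ} (hQ : Tendsto Q atTop atTop)
    (hQmono : Monotone Q) (G : ℕ → Finset ℕ)
    (hs : ∀ x ∈ s, ∀ I, ∃ i ≥ I, ∃ l ∈ G i,
      x ∈ Set.Icc ((l : ℝ) / Q i) ((l : ℝ) / Q i + 1 / Q i))
    (hsum : Summable fun i => ((G i).card : ℝ) * (1 / (Q i : ℝ)) ^ (d : ℝ)) :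
    dimH s ≤ d := by
  refine dimH_le_of_hausdorffMeasure_ne_top (ne_top_of_le_ne_top hsum.tsum_ofReal_ne_top ?_)
  let t : ∀ I : ℕ, (Σ i : ℕ, {l // l ∈ G (i + I)}) → Set ℝ := fun I p =>
    Set.Icc ((p.2.1 : ℝ) / Q (p.1 + I)) ((p.2.1 : ℝ) / Q (p.1 + I) + 1 / Q (p.1 + I))
  have hdiam : ∀ I p, Metric.ediam (t I p) = ENNReal.ofReal (1 / Q (p.1 + I)) := by
    intro I p
    simp only [t]
    rw [Real.ediam_Icc]
    congr 1
    ring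
  have hr : Tendsto (fun I => ENNReal.ofReal (1 / (Q I : ℝ))) atTop (𝓝 0) := by
    rw [← ENNReal.ofReal_zero]
    refine ENNReal.tendsto_ofReal ?_
    exact tendsto_const_nhds.div_atTop (tendsto_natCast_atTop_atTop.comp hQ)
  refine (Measure.hausdorffMeasure_le_liminf_tsum (d : ℝ) s _ hr t ?_ ?_).trans ?_
  · filter_upwards [hQ.eventually_gt_atTop 0] with I hI p
    rw [hdiam]
    refine ENNReal.ofReal_le_ofReal ?_
    have h1 : (0 : ℝ) < Q I := by exact_mod_cast hI
    have h2 : (Q I : ℝ) ≤ Q (p.1 + I) := by exact_mod_cast hQmono (Nat.le_add_left I p.1)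
    exact one_div_le_one_div_of_le h1 h2
  · refine Eventually.of_forall fun I x hx => ?_
    obtain ⟨i, hi, l, hl, hxl⟩ := hs x hx I
    obtain ⟨k, rfl⟩ := Nat.exists_eq_add_of_le' hi
    exact Set.mem_iUnion.2 ⟨⟨k, l, hl⟩, hxl⟩
  · refine (liminf_le_liminf (Eventually.of_forall fun I => ?_)).trans_eq (liminf_const _)
    have h1 : ∀ i : ℕ, ∑' l : {l // l ∈ G (i + I)}, Metric.ediam (t I ⟨i, l⟩) ^ (d : ℝ)
        = ENNReal.ofReal (((G (i + I)).card : ℝ) * (1 / (Q (i + I) : ℝ)) ^ (d : ℝ)) := by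
      intro i
      simp_rw [hdiam]
      rw [tsum_fintype, Finset.sum_const, Finset.card_univ, Fintype.card_coe, nsmul_eq_mul,
        ENNReal.ofReal_mul (by positivity), ENNReal.ofReal_natCast,
        ENNReal.ofReal_rpow_of_nonneg (by positivity) d.coe_nonneg]
    rw [ENNReal.tsum_sigma']
    simp_rw [h1]
    exact ENNReal.tsum_comp_le_tsum_of_injective (add_left_injective I)
      (fun i => ENNReal.ofReal (((G i).card : ℝ) * (1 / (Q i : ℝ)) ^ (d : ℝ)))

lemma exists_mem_grid_interval {x : ℝ} (hx : x ∈ Set.Icc (0 : ℝ) 1) {Q : ℕ} (hQ : 0 < Q) :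
    ∃ l ∈ Finset.range Q, x ∈ Set.Icc ((l : ℝ) / Q) ((l : ℝ) / Q + 1 / Q) := by
  have hQ' : (0 : ℝ) < Q := by exact_mod_cast hQ
  have hQ1 : ((Q - 1 : ℕ) : ℝ) = Q - 1 := by simp [Nat.cast_sub hQ]
  rcases hx.2.lt_or_eq with h | rfl
  · refine ⟨⌊x * Q⌋₊, ?_, ?_, ?_⟩
    · rw [Finset.mem_range, Nat.floor_lt (mul_nonneg hx.1 hQ'.le)]
      nlinarith
    · rw [div_le_iff₀ hQ']
      exact Nat.floor_le (mul_nonneg hx.1 hQ'.le)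
    · rw [← add_div, le_div_iff₀ hQ']
      exact (Nat.lt_floor_add_one _).le
  · refine ⟨Q - 1, by simp [hQ], ?_, ?_⟩
    · rw [hQ1, div_le_one hQ']
      linarith
    · rw [hQ1, ← add_div, sub_add_cancel, div_self hQ'.ne']

/-- A large sum of length `N` forces a large sum of length `M = u * 2 ^ i` with bounded `u`: keep
only the leading binary digits of `N`. -/
lemma exists_dyadic_large {f : ℕ → ℝ} {c x : ℝ} {r N i : ℕ} (hr : 2 * (1 / 2 : ℝ) ^ r ≤ c)
    (hi : Nat.log 2 N = i + r) (hN : N ≠ 0) (h : c * N ≤ ‖expSum f x N‖) :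
    ∃ u ∈ Finset.Icc 1 (2 ^ (r + 1)), c / 2 * ((u * 2 ^ i : ℕ) : ℝ) ≤ ‖expSum f x (u * 2 ^ i)‖ := by
  have h1 : 2 ^ (i + r) ≤ N := hi ▸ Nat.pow_log_le_self 2 hN
  have h2 : N < 2 ^ (i + r + 1) := hi ▸ Nat.lt_pow_succ_log_self (by norm_num) N
  have hpos : 0 < 2 ^ i := by positivity
  have hdm := Nat.div_add_mod N (2 ^ i)
  have hmod := Nat.mod_lt N hpos
  have hle : N / 2 ^ i * 2 ^ i ≤ N := Nat.div_mul_le_self N _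
  refine ⟨N / 2 ^ i, Finset.mem_Icc.2 ⟨?_, ?_⟩, ?_⟩
  · refine Nat.div_pos (le_trans ?_ h1) hpos
    exact Nat.pow_le_pow_right (by norm_num) (Nat.le_add_right _ _)
  · refine (Nat.div_lt_of_lt_mul ?_).le
    rwa [← pow_add, ← add_assoc]
  · have h3 := norm_expSum_le_add f x hle
    have h4 : (N : ℝ) - ((N / 2 ^ i * 2 ^ i : ℕ) : ℝ) ≤ 2 ^ i := by
      rw [sub_le_iff_le_add]
      have : N ≤ 2 ^ i + N / 2 ^ i * 2 ^ i := by
        rw [mul_comm]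
        omega
      exact_mod_cast this
    have h5 : (2 : ℝ) ^ i ≤ c / 2 * N := by
      have h6 : (2 : ℝ) ^ i * 2 ^ r ≤ N := by
        rw [← pow_add]
        exact_mod_cast h1
      have h7 : (1 / 2 : ℝ) ^ r * 2 ^ r = 1 := by
        rw [← mul_pow]
        norm_num
      calc (2 : ℝ) ^ i = (1 / 2 : ℝ) ^ r * (2 ^ i * 2 ^ r) := by
            rw [mul_left_comm, h7, mul_one]
        _ ≤ (1 / 2 : ℝ) ^ r * N := by gcongr
        _ ≤ c / 2 * N := by
            gcongr
            linarith
    have hc : 0 ≤ c := le_trans (by positivity) hr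
    have h8 : c / 2 * ((N / 2 ^ i * 2 ^ i : ℕ) : ℝ) ≤ c / 2 * N := by
      gcongr
    linarith

/-- Any strictly increasing integer sequence with `f n ≤ C n ^ τ` has large sums only on a set of
dimension at most `1 - 1 / τ`. -/
theorem dimH_veryLargeSumSet_le {f : ℕ → ℕ} (hf : StrictMono f) {τ C c : ℝ} (hτ : 1 ≤ τ)
    (hC : 0 ≤ C) (hfC : ∀ n, (f n : ℝ) ≤ C * (n : ℝ) ^ τ) (hc : 0 < c) :
    dimH (veryLargeSumSet (fun n => (f n : ℝ)) c) ≤ ENNReal.ofReal (1 - 1 / τ) := by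
  have hτ0 : 0 < τ := by linarith
  have hσ1 : 1 - 1 / τ < 1 := by
    have : 0 < 1 / τ := by positivity
    linarith
  have hσ0 : 0 ≤ 1 - 1 / τ := by
    rw [sub_nonneg, div_le_one hτ0]
    exact hτ
  -- it suffices to bound the dimension by every `d` with `1 - 1 / τ < d < 1`
  suffices H : ∀ d : ℝ, 1 - 1 / τ < d → d < 1 →
      dimH (veryLargeSumSet (fun n => (f n : ℝ)) c) ≤ ENNReal.ofReal d by
    have hlim : Tendsto (fun d : ℝ => ENNReal.ofReal d) (𝓝[>] (1 - 1 / τ))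
        (𝓝 (ENNReal.ofReal (1 - 1 / τ))) :=
      (ENNReal.continuous_ofReal.tendsto _).mono_left nhdsWithin_le_nhds
    refine ge_of_tendsto hlim ?_
    filter_upwards [Ioo_mem_nhdsGT hσ1] with d hd using H d hd.1 hd.2
  intro d hd1 hd2
  have hd0 : 0 < d := by linarith
  obtain ⟨r, hr⟩ := exists_pow_lt_of_lt_one (half_pos hc) (show (1 / 2 : ℝ) < 1 by norm_num)
  set U : ℕ := 2 ^ (r + 1) with hU
  -- half of `c` is lost in rounding `N` to `u * 2 ^ i`, half of the rest in moving `x` to the grid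
  set a : ℝ := c / 4 with ha_def
  have ha : 0 < a := by positivity
  have hUpos : (0 : ℝ) < U := by positivity
  set K : ℝ := (2 * Real.pi / a + 1) * (C * (U : ℝ) ^ τ) with hK
  have hK0 : 0 ≤ K := by have := Real.pi_pos; positivity
  -- the summand `2 ^ i` makes `Q` tend to infinity even if `C = 0`
  let Q : ℕ → ℕ := fun i => ⌊K * ((2 : ℝ) ^ i) ^ τ + 2 ^ i⌋₊ + 1
  have hpow1 : ∀ i : ℕ, (2 : ℝ) ^ i ≤ ((2 : ℝ) ^ i) ^ τ := fun i =>
    Real.self_le_rpow_of_one_le (one_le_pow₀ (by norm_num)) hτ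
  have hQlt : ∀ i, K * ((2 : ℝ) ^ i) ^ τ + 2 ^ i < Q i := fun i => by
    simp only [Q]
    push_cast
    exact Nat.lt_floor_add_one _
  have hQle : ∀ i, (Q i : ℝ) ≤ (K + 2) * ((2 : ℝ) ^ i) ^ τ := fun i => by
    have h1 : (⌊K * ((2 : ℝ) ^ i) ^ τ + 2 ^ i⌋₊ : ℝ) ≤ K * ((2 : ℝ) ^ i) ^ τ + 2 ^ i :=
      Nat.floor_le (by positivity)
    have h2 : (1 : ℝ) ≤ 2 ^ i := one_le_pow₀ (by norm_num)
    have h3 := hpow1 i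
    simp only [Q]
    push_cast
    nlinarith
  have hQmono : Monotone Q := fun i j hij => by
    have : (2 : ℝ) ^ i ≤ 2 ^ j := pow_le_pow_right₀ (by norm_num) hij
    simp only [Q]
    gcongr
  have hQpos : ∀ i, (0 : ℝ) < Q i := fun i => lt_of_le_of_lt (by positivity) (hQlt i)
  have hQtop : Tendsto Q atTop atTop := by
    refine tendsto_natCast_atTop_iff (R := ℝ) |>.1 ?_
    refine tendsto_atTop_mono (fun i => ?_)
      (tendsto_pow_atTop_atTop_of_one_lt (show (1 : ℝ) < 2 by norm_num))
    have := hQlt i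
    have : 0 ≤ K * ((2 : ℝ) ^ i) ^ τ := by positivity
    linarith
  -- the mesh `1 / Q i` is fine enough for all lengths `u * 2 ^ i` with `u ≤ U`
  have hfQ : ∀ i, ∀ u ∈ Finset.Icc 1 U,
      2 * Real.pi * f (u * 2 ^ i) ≤ a * Q i ∧ f (u * 2 ^ i) < Q i := by
    intro i u hu
    have hu' : (u : ℝ) ≤ U := by exact_mod_cast (Finset.mem_Icc.1 hu).2
    have h1 : (f (u * 2 ^ i) : ℝ) ≤ C * (U : ℝ) ^ τ * ((2 : ℝ) ^ i) ^ τ := by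
      refine (hfC _).trans ?_
      rw [mul_assoc, ← Real.mul_rpow hUpos.le (by positivity)]
      push_cast
      gcongr
    have h2 : (2 * Real.pi / a + 1) * (f (u * 2 ^ i) : ℝ) < Q i := by
      refine lt_of_le_of_lt ?_ (hQlt i)
      have hpi := Real.pi_pos
      have : (2 * Real.pi / a + 1) * (f (u * 2 ^ i) : ℝ)
          ≤ (2 * Real.pi / a + 1) * (C * (U : ℝ) ^ τ * ((2 : ℝ) ^ i) ^ τ) := by gcongr
      have h3 : (0 : ℝ) ≤ 2 ^ i := by positivity
      rw [hK]
      nlinarith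
    have hf0 : (0 : ℝ) ≤ f (u * 2 ^ i) := Nat.cast_nonneg _
    have h3 : 2 * Real.pi / a * (f (u * 2 ^ i) : ℝ) + f (u * 2 ^ i) < Q i := by linarith
    have h4 : 0 ≤ 2 * Real.pi / a * (f (u * 2 ^ i) : ℝ) := by have := Real.pi_pos; positivity
    constructor
    · have h5 : 2 * Real.pi / a * (f (u * 2 ^ i) : ℝ) ≤ Q i := by linarith
      have h6 : 2 * Real.pi * (f (u * 2 ^ i) : ℝ) = a * (2 * Real.pi / a * f (u * 2 ^ i)) := by
        field_simp
      rw [h6]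
      gcongr
    · have : (f (u * 2 ^ i) : ℝ) < Q i := by linarith
      exact_mod_cast this
  let G : ℕ → Finset ℕ := fun i => (Finset.Icc 1 U).biUnion fun u =>
    (Finset.range (Q i)).filter (fun l : ℕ => a * ((u * 2 ^ i : ℕ) : ℝ)
      ≤ ‖expSum (fun n => (f n : ℝ)) ((l : ℝ) / Q i) (u * 2 ^ i)‖)
  have hGcard : ∀ i, ((G i).card : ℝ) ≤ U / a ^ 2 * (Q i / 2 ^ i) := by
    intro i
    have h1 : ((G i).card : ℝ) ≤ ∑ u ∈ Finset.Icc 1 U,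
        (((Finset.range (Q i)).filter (fun l : ℕ => a * ((u * 2 ^ i : ℕ) : ℝ)
          ≤ ‖expSum (fun n => (f n : ℝ)) ((l : ℝ) / Q i) (u * 2 ^ i)‖)).card : ℝ) := by
      exact_mod_cast Finset.card_biUnion_le
    refine h1.trans ?_
    have h2 : ∀ u ∈ Finset.Icc 1 U,
        (((Finset.range (Q i)).filter (fun l : ℕ => a * ((u * 2 ^ i : ℕ) : ℝ)
          ≤ ‖expSum (fun n => (f n : ℝ)) ((l : ℝ) / Q i) (u * 2 ^ i)‖)).card : ℝ)
          ≤ Q i / (a ^ 2 * 2 ^ i) := by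
      intro u hu
      have hu1 : 1 ≤ u := (Finset.mem_Icc.1 hu).1
      refine (card_filter_le_norm_expSum hf (Nat.mul_pos hu1 (by positivity))
        (hfQ i u hu).2 ha).trans ?_
      have hu1' : (1 : ℝ) ≤ u := by exact_mod_cast hu1
      have h3 : (2 : ℝ) ^ i ≤ ((u * 2 ^ i : ℕ) : ℝ) := by
        push_cast
        exact le_mul_of_one_le_left (by positivity) hu1'
      gcongr
    refine (Finset.sum_le_sum h2).trans_eq ?_
    rw [Finset.sum_const, Nat.card_Icc, nsmul_eq_mul, Nat.add_sub_cancel]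
    field_simp
  have hcoe : ENNReal.ofReal d = ((d.toNNReal : ℝ≥0) : ℝ≥0∞) := rfl
  rw [hcoe]
  refine dimH_le_of_grid_cover hQtop hQmono G ?_ ?_
  · rintro x ⟨hx, hinf⟩ I
    obtain ⟨N, hN, hNI⟩ := hinf.exists_gt (2 ^ (I + r))
    have hN0 : N ≠ 0 := (Nat.zero_le _ |>.trans_lt hNI).ne'
    have hlog : I + r ≤ Nat.log 2 N := Nat.le_log_of_pow_le (by norm_num) hNI.le
    obtain ⟨k, hk⟩ := Nat.exists_eq_add_of_le hlog
    refine ⟨I + k, Nat.le_add_right _ _, ?_⟩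
    obtain ⟨u, hu, hux⟩ := exists_dyadic_large (i := I + k) (r := r) (by linarith)
      (by omega) hN0 hN
    obtain ⟨l, hl, hxl⟩ := exists_mem_grid_interval hx
      (show 0 < Q (I + k) by exact_mod_cast hQpos (I + k))
    refine ⟨l, Finset.mem_biUnion.2 ⟨u, hu, Finset.mem_filter.2 ⟨hl, ?_⟩⟩, hxl⟩
    set M := u * 2 ^ (I + k) with hM
    have h1 := norm_expSum_sub_le hf.monotone x ((l : ℝ) / Q (I + k)) M
    have h2 : |x - (l : ℝ) / Q (I + k)| ≤ 1 / Q (I + k) := by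
      rw [abs_le]
      have : (0 : ℝ) ≤ 1 / Q (I + k) := by have := hQpos (I + k); positivity
      constructor <;> linarith [hxl.1, hxl.2]
    have h3 : 2 * Real.pi * |x - (l : ℝ) / Q (I + k)| * f M * M ≤ a * M := by
      have h4 := (hfQ (I + k) u hu).1
      rw [← hM] at h4
      have hpi := Real.pi_pos
      have hq := hQpos (I + k)
      calc 2 * Real.pi * |x - (l : ℝ) / Q (I + k)| * f M * M
          ≤ 2 * Real.pi * (1 / Q (I + k)) * f M * M := by gcongr
        _ = (2 * Real.pi * f M) / Q (I + k) * M := by ring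
        _ ≤ (a * Q (I + k)) / Q (I + k) * M := by gcongr
        _ = a * M := by field_simp
    have h5 := norm_sub_norm_le (expSum (fun n => (f n : ℝ)) x M)
      (expSum (fun n => (f n : ℝ)) ((l : ℝ) / Q (I + k)) M)
    rw [ha_def] at *
    linarith
  · -- the `i`-th term is at most a constant times `2 ^ (i * (τ * (1 - d) - 1))`
    rw [Real.coe_toNNReal d hd0.le]
    have hρ1 : (2 : ℝ) ^ (τ * (1 - d) - 1) < 1 := by
      refine Real.rpow_lt_one_of_one_lt_of_neg (by norm_num) ?_
      have h1 : 1 - d < 1 / τ := by linarith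
      have h2 := mul_lt_mul_of_pos_left h1 hτ0
      rw [mul_one_div_cancel hτ0.ne'] at h2
      linarith
    refine Summable.of_nonneg_of_le (fun i => by positivity) (fun i => ?_)
      ((summable_geometric_of_lt_one (by positivity) hρ1).mul_left
        (U / a ^ 2 * (K + 2) ^ (1 - d)))
    have hq := hQpos i
    have h2i : (0 : ℝ) < 2 ^ i := by positivity
    calc ((G i).card : ℝ) * (1 / (Q i : ℝ)) ^ d
        ≤ U / a ^ 2 * (Q i / 2 ^ i) * (1 / (Q i : ℝ)) ^ d := by
          gcongr
          exact hGcard i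
      _ = U / a ^ 2 * ((Q i : ℝ) ^ (1 - d) / 2 ^ i) := by
          rw [Real.rpow_sub hq, Real.rpow_one, Real.div_rpow zero_le_one hq.le, Real.one_rpow]
          ring
      _ ≤ U / a ^ 2 * (((K + 2) * ((2 : ℝ) ^ i) ^ τ) ^ (1 - d) / 2 ^ i) := by
          have h1d : 0 ≤ 1 - d := by linarith
          gcongr
          exact hQle i
      _ = U / a ^ 2 * (K + 2) ^ (1 - d) * ((2 : ℝ) ^ (τ * (1 - d) - 1)) ^ i := by
          rw [Real.mul_rpow (by positivity) (by positivity), ← Real.rpow_mul h2i.le,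
            ← Real.rpow_natCast (2 ^ (τ * (1 - d) - 1)) i, ← Real.rpow_mul (by norm_num),
            mul_comm (τ * (1 - d) - 1) (i : ℝ), Real.rpow_mul (x := 2) (by norm_num), Real.rpow_natCast,
            Real.rpow_sub_one h2i.ne']
          ring

/-! ### Spreading out binary digits -/

/-- The binary digit of `y` of weight `2 ^ (-(i + 1))`, as a real number. -/
noncomputable def binDigit (y : ℝ) (i : ℕ) : ℝ := (⌊2 ^ (i + 1) * y⌋ : ℝ) - 2 * ⌊2 ^ i * y⌋

/-- The first `m` binary digits of `y`, with the digit number `i` moved to the position `p i`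
(digits being numbered from `1`). -/
noncomputable def spreadTrunc (p : ℕ → ℕ) (y : ℝ) (m : ℕ) : ℝ :=
  ∑ i ∈ Finset.range m, binDigit y i * (1 / 2) ^ p (i + 1)

/-- The number obtained from `y` by moving its binary digit number `i` to the position `p i`, for
all `i ≥ 1`, and putting `0` at the remaining positions. -/
noncomputable def spread (p : ℕ → ℕ) (y : ℝ) : ℝ := ⨆ m, spreadTrunc p y m

lemma binDigit_eq_zero_or_one (y : ℝ) (i : ℕ) : binDigit y i = 0 ∨ binDigit y i = 1 := by
  have h1 := Int.floor_le (2 ^ i * y)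
  have h2 := Int.lt_floor_add_one (2 ^ i * y)
  have h3 := Int.floor_le (2 ^ (i + 1) * y)
  have h4 := Int.lt_floor_add_one (2 ^ (i + 1) * y)
  have h5 : (2 : ℝ) ^ (i + 1) * y = 2 * (2 ^ i * y) := by ring
  have h6 : 2 * ⌊2 ^ i * y⌋ ≤ ⌊2 ^ (i + 1) * y⌋ := by
    rw [Int.le_floor, h5]
    push_cast
    linarith
  have h7 : ⌊2 ^ (i + 1) * y⌋ < 2 * ⌊2 ^ i * y⌋ + 2 := by
    rw [Int.floor_lt, h5]
    push_cast
    linarith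
  have h8 : ⌊2 ^ (i + 1) * y⌋ = 2 * ⌊2 ^ i * y⌋ ∨ ⌊2 ^ (i + 1) * y⌋ = 2 * ⌊2 ^ i * y⌋ + 1 := by
    omega
  unfold binDigit
  rcases h8 with h | h <;> rw [h] <;> simp

lemma binDigit_nonneg (y : ℝ) (i : ℕ) : 0 ≤ binDigit y i := by
  rcases binDigit_eq_zero_or_one y i with h | h
  · exact h.ge
  · exact zero_le_one.trans_eq h.symm

lemma binDigit_le_one (y : ℝ) (i : ℕ) : binDigit y i ≤ 1 := by
  rcases binDigit_eq_zero_or_one y i with h | h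
  · exact h.trans_le zero_le_one
  · exact h.le

lemma spreadTrunc_succ (p : ℕ → ℕ) (y : ℝ) (m : ℕ) :
    spreadTrunc p y (m + 1) = spreadTrunc p y m + binDigit y m * (1 / 2) ^ p (m + 1) :=
  Finset.sum_range_succ _ _

lemma monotone_spreadTrunc (p : ℕ → ℕ) (y : ℝ) : Monotone (spreadTrunc p y) :=
  monotone_nat_of_le_succ fun m => by
    rw [spreadTrunc_succ]
    have := binDigit_nonneg y m
    exact le_add_of_nonneg_right (by positivity)

lemma two_mul_half_pow_le {p : ℕ → ℕ} (hp : StrictMono p) (m : ℕ) :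
    2 * (1 / 2 : ℝ) ^ p (m + 1) ≤ (1 / 2) ^ p m := by
  have h : (1 / 2 : ℝ) ^ p (m + 1) ≤ (1 / 2) ^ (p m + 1) :=
    pow_le_pow_of_le_one (by norm_num) (by norm_num) (hp (Nat.lt_succ_self m))
  rw [pow_succ] at h
  linarith

lemma antitone_spreadTrunc_add {p : ℕ → ℕ} (hp : StrictMono p) (y : ℝ) :
    Antitone fun m => spreadTrunc p y m + (1 / 2) ^ p m :=
  antitone_nat_of_succ_le fun m => by
    have h1 := two_mul_half_pow_le hp m
    have h2 : binDigit y m * (1 / 2) ^ p (m + 1) ≤ 1 * (1 / 2) ^ p (m + 1) := by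
      gcongr
      exact binDigit_le_one y m
    rw [spreadTrunc_succ]
    linarith

lemma spreadTrunc_le_spreadTrunc_add {p : ℕ → ℕ} (hp : StrictMono p) (y : ℝ) (n m : ℕ) :
    spreadTrunc p y n ≤ spreadTrunc p y m + (1 / 2) ^ p m := by
  refine (monotone_spreadTrunc p y (le_max_left n m)).trans
    (le_trans ?_ (antitone_spreadTrunc_add hp y (le_max_right n m)))
  exact le_add_of_nonneg_right (by positivity)

lemma spread_le {p : ℕ → ℕ} (hp : StrictMono p) (y : ℝ) (m : ℕ) :
    spread p y ≤ spreadTrunc p y m + (1 / 2) ^ p m :=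
  ciSup_le fun n => spreadTrunc_le_spreadTrunc_add hp y n m

lemma spreadTrunc_le_spread {p : ℕ → ℕ} (hp : StrictMono p) (y : ℝ) (m : ℕ) :
    spreadTrunc p y m ≤ spread p y := by
  refine le_ciSup (f := spreadTrunc p y) ⟨spreadTrunc p y 0 + (1 / 2) ^ p 0, ?_⟩ m
  rintro _ ⟨n, rfl⟩
  exact spreadTrunc_le_spreadTrunc_add hp y n 0

lemma spread_mem_Icc {p : ℕ → ℕ} (hp : StrictMono p) (y : ℝ) : spread p y ∈ Set.Icc (0 : ℝ) 1 := by
  have h0 : spreadTrunc p y 0 = 0 := by simp [spreadTrunc]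
  refine ⟨h0 ▸ spreadTrunc_le_spread hp y 0, (spread_le hp y 0).trans ?_⟩
  rw [h0, zero_add]
  exact pow_le_one₀ (by norm_num) (by norm_num)

lemma exists_int_eq_two_pow_mul_spreadTrunc {p : ℕ → ℕ} (hp : StrictMono p) (y : ℝ) (a : ℕ) :
    ∀ m, p m ≤ a → ∃ k : ℤ, (2 : ℝ) ^ a * spreadTrunc p y m = k
  | 0, _ => ⟨0, by simp [spreadTrunc]⟩
  | m + 1, h => by
    obtain ⟨k, hk⟩ := exists_int_eq_two_pow_mul_spreadTrunc hp y a m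
      ((hp.monotone m.le_succ).trans h)
    obtain ⟨b, rfl⟩ := Nat.exists_eq_add_of_le h
    have h1 : (2 : ℝ) ^ (p (m + 1) + b) * (1 / 2) ^ p (m + 1) = 2 ^ b := by
      rw [pow_add, mul_right_comm, ← mul_pow]
      norm_num
    rw [spreadTrunc_succ, mul_add, hk, mul_left_comm, h1]
    rcases binDigit_eq_zero_or_one y m with h | h <;> rw [h]
    · exact ⟨k, by simp⟩
    · exact ⟨k + 2 ^ b, by push_cast; ring⟩

/-- If `p` skips the positions `a + 1, …, a + b`, then `2 ^ a * spread p y` is close to an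
integer. -/
lemma exists_int_abs_two_pow_mul_spread_sub_le {p : ℕ → ℕ} (hp : StrictMono p) (y : ℝ)
    {a b m : ℕ} (h1 : p m ≤ a) (h2 : a + b < p (m + 1)) :
    ∃ k : ℤ, |2 ^ a * spread p y - k| ≤ (1 / 2) ^ b := by
  obtain ⟨k, hk⟩ := exists_int_eq_two_pow_mul_spreadTrunc hp y a m h1
  refine ⟨k, ?_⟩
  have h3 := spreadTrunc_le_spread hp y m
  have h4 : spread p y ≤ spreadTrunc p y m + (1 / 2) ^ (a + b) := by
    refine (spread_le hp y (m + 1)).trans ?_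
    have h5 : binDigit y m * (1 / 2) ^ p (m + 1) ≤ 1 * (1 / 2) ^ p (m + 1) := by
      gcongr
      exact binDigit_le_one y m
    have h6 : (1 / 2 : ℝ) ^ p (m + 1) ≤ (1 / 2) ^ (a + b + 1) :=
      pow_le_pow_of_le_one (by norm_num) (by norm_num) h2
    rw [pow_succ] at h6
    rw [spreadTrunc_succ]
    linarith
  have h7 : (2 : ℝ) ^ a * (1 / 2) ^ (a + b) = (1 / 2) ^ b := by
    rw [pow_add, ← mul_assoc, ← mul_pow]
    norm_num
  rw [← hk, ← mul_sub, ← h7, abs_of_nonneg (mul_nonneg (by positivity) (by linarith))]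
  gcongr
  linarith

/-- The integer `2 ^ p m * spreadTrunc p y m` is strictly increasing as a function of
`⌊2 ^ m * y⌋`. -/
lemma floor_sub_mul_le_spreadTrunc_sub {p : ℕ → ℕ} (hp : StrictMono p) {y z : ℝ}
    (hy : y ∈ Set.Ico (0 : ℝ) 1) (hz : z ∈ Set.Ico (0 : ℝ) 1) (hyz : y ≤ z) (m : ℕ) :
    ((⌊2 ^ m * z⌋ : ℝ) - ⌊2 ^ m * y⌋) * (1 / 2) ^ p m
      ≤ spreadTrunc p z m - spreadTrunc p y m := by
  induction m with
  | zero =>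
    have h1 : ⌊y⌋ = 0 := Int.floor_eq_zero_iff.2 hy
    have h2 : ⌊z⌋ = 0 := Int.floor_eq_zero_iff.2 hz
    simp [spreadTrunc, h1, h2]
  | succ m ih =>
    have h1 : (0 : ℝ) ≤ (⌊2 ^ m * z⌋ : ℝ) - ⌊2 ^ m * y⌋ := by
      rw [sub_nonneg]
      exact_mod_cast Int.floor_mono (mul_le_mul_of_nonneg_left hyz (by positivity))
    have h2 := mul_le_mul_of_nonneg_left (two_mul_half_pow_le hp m) h1
    have h3 : (⌊2 ^ (m + 1) * z⌋ : ℝ) - ⌊2 ^ (m + 1) * y⌋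
        = 2 * ((⌊2 ^ m * z⌋ : ℝ) - ⌊2 ^ m * y⌋) + (binDigit z m - binDigit y m) := by
      unfold binDigit
      ring
    rw [spreadTrunc_succ, spreadTrunc_succ, h3]
    linarith

lemma half_pow_le_spread_sub {p : ℕ → ℕ} (hp : StrictMono p) {y z : ℝ}
    (hy : y ∈ Set.Ico (0 : ℝ) 1) (hz : z ∈ Set.Ico (0 : ℝ) 1) {m : ℕ} (h : 2 ≤ 2 ^ m * (z - y)) :
    (1 / 2) ^ p m ≤ spread p z - spread p y := by
  have hyz : y ≤ z := by
    by_contra! hlt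
    have : 2 ^ m * (z - y) ≤ 0 := mul_nonpos_of_nonneg_of_nonpos (by positivity) (by linarith)
    linarith
  have h1 : ⌊2 ^ m * y⌋ + 2 ≤ ⌊2 ^ m * z⌋ := by
    rw [Int.le_floor]
    have := Int.floor_le (2 ^ m * y)
    push_cast
    linarith
  have h2 : (2 : ℝ) ≤ (⌊2 ^ m * z⌋ : ℝ) - ⌊2 ^ m * y⌋ := by
    have : ((⌊2 ^ m * y⌋ + 2 : ℤ) : ℝ) ≤ ⌊2 ^ m * z⌋ := by exact_mod_cast h1
    push_cast at this
    linarith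
  have h3 := floor_sub_mul_le_spreadTrunc_sub hp hy hz hyz m
  have h4 : 2 * (1 / 2 : ℝ) ^ p m ≤ ((⌊2 ^ m * z⌋ : ℝ) - ⌊2 ^ m * y⌋) * (1 / 2) ^ p m := by
    gcongr
  have h5 := spread_le hp y m
  have h6 := spreadTrunc_le_spread hp z m
  linarith

lemma sub_le_mul_spread_sub_rpow {p : ℕ → ℕ} (hp : StrictMono p) {t D : ℝ} (ht : 0 < t)
    (hpt : ∀ m, (p m : ℝ) ≤ t * m + D) {y z : ℝ}
    (hy : y ∈ Set.Ico (0 : ℝ) 1) (hz : z ∈ Set.Ico (0 : ℝ) 1) (hyz : y < z) :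
    z - y ≤ 4 * 2 ^ (D / t) * (spread p z - spread p y) ^ (1 / t) := by
  obtain ⟨n, hn1, hn2⟩ := exists_nat_pow_near_of_lt_one (sub_pos.2 hyz)
    (show z - y ≤ 1 by linarith [hy.1, hz.2]) (show (0 : ℝ) < 1 / 2 by norm_num) (by norm_num)
  have h2 : ∀ k : ℕ, (2 : ℝ) ^ k * (1 / 2) ^ k = 1 := fun k => by
    rw [← mul_pow]
    norm_num
  have h1 := half_pow_le_spread_sub hp hy hz (m := n + 2) (by
    have h3 : (2 : ℝ) ^ (n + 2) * (1 / 2) ^ (n + 1) ≤ 2 ^ (n + 2) * (z - y) := by gcongr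
    have h4 := h2 (n + 1)
    have h5 : (2 : ℝ) ^ (n + 2) * (1 / 2) ^ (n + 1) = 2 * (2 ^ (n + 1) * (1 / 2) ^ (n + 1)) := by
      ring
    linarith)
  have h3 : ((1 / 2 : ℝ) ^ p (n + 2)) ^ (1 / t) ≤ (spread p z - spread p y) ^ (1 / t) := by
    gcongr
  have h4 : (2 : ℝ) ^ (D / t) * ((1 / 2 : ℝ) ^ p (n + 2)) ^ (1 / t) ≥ (1 / 2) ^ (n + 2) := by
    have e1 : ((1 / 2 : ℝ) ^ p (n + 2)) = (2 : ℝ) ^ (-(p (n + 2) : ℝ)) := by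
      rw [Real.rpow_neg (by norm_num), Real.rpow_natCast, one_div, inv_pow]
    have e2 : ((1 / 2 : ℝ) ^ (n + 2)) = (2 : ℝ) ^ (-((n + 2 : ℕ) : ℝ)) := by
      rw [Real.rpow_neg (by norm_num), Real.rpow_natCast, one_div, inv_pow]
    rw [e1, e2, ← Real.rpow_mul (by norm_num), ← Real.rpow_add (by norm_num)]
    refine Real.rpow_le_rpow_of_exponent_le (by norm_num) ?_
    have h5 := hpt (n + 2)
    have h6 : (p (n + 2) : ℝ) * (1 / t) ≤ ((n + 2 : ℕ) : ℝ) + D / t := by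
      rw [mul_one_div, div_le_iff₀ ht, add_mul, div_mul_cancel₀ _ ht.ne', mul_comm _ t]
      exact h5
    linarith
  have h5 : (1 / 2 : ℝ) ^ n = 4 * (1 / 2) ^ (n + 2) := by
    rw [pow_add]
    norm_num
    ring
  calc z - y ≤ 4 * (1 / 2) ^ (n + 2) := h5 ▸ hn2
    _ ≤ 4 * (2 ^ (D / t) * ((1 / 2 : ℝ) ^ p (n + 2)) ^ (1 / t)) := by gcongr
    _ ≤ 4 * (2 ^ (D / t) * (spread p z - spread p y) ^ (1 / t)) := by gcongr
    _ = _ := by ring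

/-- If `p` grows linearly with slope `t`, the numbers with free binary digits at the positions
`p 1, p 2, …` form a set of dimension at least `1 / t`: the inverse of `spread p` is
`1 / t`-Hölder, and it maps this set onto `[0, 1)`. -/
theorem le_dimH_image_spread {p : ℕ → ℕ} (hp : StrictMono p) {t D : ℝ} (ht : 0 < t)
    (hpt : ∀ m, (p m : ℝ) ≤ t * m + D) :
    ENNReal.ofReal (1 / t) ≤ dimH (spread p '' Set.Ico (0 : ℝ) 1) := by
  set S := Set.Ico (0 : ℝ) 1
  set K : ℝ := 4 * 2 ^ (D / t) with hK
  have hK0 : 0 ≤ K := by positivity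
  have hmain : ∀ y ∈ S, ∀ z ∈ S, |y - z| ≤ K * |spread p y - spread p z| ^ (1 / t) := by
    have hlt : ∀ y ∈ S, ∀ z ∈ S, y < z →
        |y - z| ≤ K * |spread p y - spread p z| ^ (1 / t) := by
      intro y hy z hz hyz
      rw [abs_sub_comm, abs_of_pos (sub_pos.2 hyz), abs_sub_comm (spread p y)]
      refine (sub_le_mul_spread_sub_rpow hp ht hpt hy hz hyz).trans ?_
      obtain ⟨n, hn⟩ := exists_nat_gt (2 / (z - y))
      have h1 : 2 ≤ 2 ^ n * (z - y) := by
        rw [← div_le_iff₀ (sub_pos.2 hyz)]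
        have : (n : ℝ) ≤ 2 ^ n := by exact_mod_cast Nat.lt_two_pow_self.le
        linarith
      have h2 : 0 ≤ spread p z - spread p y :=
        le_trans (by positivity) (half_pow_le_spread_sub hp hy hz h1)
      rw [abs_of_nonneg h2]
    intro y hy z hz
    rcases lt_trichotomy y z with h | rfl | h
    · exact hlt y hy z hz h
    · simp only [sub_self, abs_zero]
      positivity
    · rw [abs_sub_comm, abs_sub_comm (spread p y)]
      exact hlt z hz y hy h
  have hinj : Set.InjOn (spread p) S := by
    intro y hy z hz hyz
    have h := hmain y hy z hz
    rw [hyz, sub_self, abs_zero, Real.zero_rpow (by positivity), mul_zero] at h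
    exact sub_eq_zero.1 (abs_eq_zero.1 (le_antisymm h (abs_nonneg _)))
  have hleft := hinj.leftInvOn_invFunOn
  have hholder : HolderOnWith K.toNNReal (1 / t).toNNReal (Function.invFunOn (spread p) S)
      (spread p '' S) := by
    rintro _ ⟨y, hy, rfl⟩ _ ⟨z, hz, rfl⟩
    rw [hleft hy, hleft hz, edist_dist, edist_dist, Real.dist_eq, Real.dist_eq,
      Real.coe_toNNReal _ (by positivity),
      ENNReal.ofReal_rpow_of_nonneg (abs_nonneg _) (by positivity)]
    change _ ≤ ENNReal.ofReal K * _
    rw [← ENNReal.ofReal_mul hK0]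
    exact ENNReal.ofReal_le_ofReal (hmain y hy z hz)
  have hpos : 0 < (1 / t).toNNReal := Real.toNNReal_pos.2 (by positivity)
  have h1 := hholder.dimH_image_le hpos
  have h2 : dimH S = 1 := by
    rw [Real.dimH_of_nonempty_interior]
    · simp
    · rw [interior_Ico]
      exact Set.nonempty_Ioo.2 zero_lt_one
  rw [hleft.image_image, h2] at h1
  have h3 := mul_le_of_le_div h1
  rwa [one_mul] at h3

/-! ### Sparse long gaps -/

/-- The largest number of the form `2 ^ 2 ^ k` not exceeding `m` (and `2` if `m ≤ 1`). -/
def doubleExpFloor (m : ℕ) : ℕ := 2 ^ 2 ^ Nat.log 2 (Nat.log 2 m)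

lemma monotone_doubleExpFloor : Monotone doubleExpFloor := fun m n h => by
  unfold doubleExpFloor
  gcongr <;> norm_num

lemma doubleExpFloor_le (m : ℕ) : doubleExpFloor m ≤ m + 2 := by
  unfold doubleExpFloor
  rcases lt_or_ge m 2 with h | h
  · simp [Nat.log_of_lt h]
  · have h1 : Nat.log 2 m ≠ 0 := (Nat.log_pos (by norm_num) h).ne'
    have h2 := Nat.pow_log_le_self 2 h1
    calc 2 ^ 2 ^ Nat.log 2 (Nat.log 2 m) ≤ 2 ^ Nat.log 2 m := Nat.pow_le_pow_right (by norm_num) h2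
      _ ≤ m := Nat.pow_log_le_self 2 (by omega)
      _ ≤ m + 2 := Nat.le_add_right _ _

lemma doubleExpFloor_two_pow_two_pow (k : ℕ) : doubleExpFloor (2 ^ 2 ^ k) = 2 ^ 2 ^ k := by
  simp [doubleExpFloor, Nat.log_pow]

lemma doubleExpFloor_of_succ_eq {m k : ℕ} (h : m + 1 = 2 ^ 2 ^ (k + 1)) :
    doubleExpFloor m = 2 ^ 2 ^ k := by
  have h0 : 2 ^ (k + 1) = 2 * 2 ^ k := by ring
  have hpos : 0 < 2 ^ k := by positivity
  have h1 : Nat.log 2 m = 2 ^ (k + 1) - 1 := by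
    have h2 : 2 ^ 2 ^ (k + 1) = 2 * 2 ^ (2 ^ (k + 1) - 1) := by
      rw [← pow_succ']
      congr 1
      omega
    have h3 : 0 < 2 ^ (2 ^ (k + 1) - 1) := by positivity
    have h4 : 2 ^ (2 ^ (k + 1) - 1) * 2 = 2 * 2 ^ (2 ^ (k + 1) - 1) := by ring
    refine Nat.log_eq_of_pow_le_of_lt_pow (by omega) ?_
    rw [pow_succ]
    omega
  have h5 : Nat.log 2 (2 ^ (k + 1) - 1) = k :=
    Nat.log_eq_of_pow_le_of_lt_pow (by omega) (by omega)
  rw [doubleExpFloor, h1, h5]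

/-- A sequence of positions of slope `1 + κ` whose gaps, at sparse places `m`, have length about
`κ * m`. -/
noncomputable def gapPos (κ : ℝ) (m : ℕ) : ℕ := m + ⌈κ * doubleExpFloor m⌉₊

lemma strictMono_gapPos {κ : ℝ} (hκ : 0 ≤ κ) : StrictMono (gapPos κ) :=
  strictMono_id.add_monotone fun m n h => by
    have : (doubleExpFloor m : ℝ) ≤ doubleExpFloor n := by
      exact_mod_cast monotone_doubleExpFloor h
    gcongr

lemma gapPos_le {κ : ℝ} (hκ : 0 ≤ κ) (m : ℕ) :
    (gapPos κ m : ℝ) ≤ (1 + κ) * m + (2 * κ + 1) := by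
  have h1 := (Nat.ceil_lt_add_one (show 0 ≤ κ * doubleExpFloor m by positivity)).le
  have h2 : (doubleExpFloor m : ℝ) ≤ m + 2 := by exact_mod_cast doubleExpFloor_le m
  have h3 : κ * doubleExpFloor m ≤ κ * (m + 2) := by gcongr
  unfold gapPos
  push_cast
  linarith

/-- For `κ > 1 / (τ - 1)`, infinitely many of the windows that start behind the position
`⌊(τ - 1) * j⌋₊` and have length `j + 5` lie in a gap of `gapPos κ`. -/
lemma exists_window_in_gap {τ κ : ℝ} (hτ : 1 < τ) (hκ : 1 / (τ - 1) < κ) (J : ℕ) :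
    ∃ j ≥ J, ∃ m, gapPos κ m ≤ ⌊(τ - 1) * j⌋₊ ∧ ⌊(τ - 1) * j⌋₊ + (j + 5) < gapPos κ (m + 1) := by
  have hτ1 : 0 < τ - 1 := by linarith
  have hκ0 : 0 < κ := lt_trans (by positivity) hκ
  have hδ : 0 < κ - 1 / (τ - 1) := by linarith
  set δ := κ - 1 / (τ - 1) with hδdef
  set B := τ / (τ - 1) * κ with hB
  have hB0 : 0 < B := by positivity
  obtain ⟨k, hk⟩ := exists_nat_gt (max ((B + (τ + 5)) / δ) ((τ - 1) * J))
  set T : ℕ := 2 ^ 2 ^ k with hT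
  have hkT : (k : ℝ) < T := by
    have : k < T := Nat.lt_two_pow_self.trans Nat.lt_two_pow_self
    exact_mod_cast this
  have hT2 : 2 ≤ T := by
    calc 2 = 2 ^ 1 := rfl
      _ ≤ 2 ^ 2 ^ k := Nat.pow_le_pow_right (by norm_num) (Nat.one_le_two_pow)
  have hT2' : (2 : ℝ) ≤ T := by exact_mod_cast hT2
  have hTT : 2 ^ 2 ^ (k + 1) = T * T := by
    rw [hT, pow_succ 2 k, pow_mul, sq]
  have hTTpos : 1 ≤ T * T := Nat.mul_pos (by omega) (by omega)
  obtain ⟨m, hm⟩ : ∃ m, m + 1 = T * T := ⟨T * T - 1, by omega⟩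
  have hmR : (m : ℝ) + 1 = T * T := by exact_mod_cast hm
  have hp1 : (gapPos κ m : ℝ) ≤ T * T + κ * T := by
    unfold gapPos
    rw [doubleExpFloor_of_succ_eq (k := k) (by rw [hTT, hm]), ← hT]
    have := Nat.ceil_lt_add_one (show 0 ≤ κ * T by positivity)
    push_cast
    linarith
  have hp0 : (m : ℝ) ≤ gapPos κ m := by
    exact_mod_cast Nat.le_add_right m _
  have hp2 : (T * T : ℝ) + κ * (T * T) ≤ gapPos κ (m + 1) := by
    unfold gapPos
    rw [hm, ← hTT, doubleExpFloor_two_pow_two_pow, hTT]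
    have := Nat.le_ceil (κ * ((T * T : ℕ) : ℝ))
    push_cast at this ⊢
    linarith
  -- the first window that starts behind the position `gapPos κ m`
  set j := ⌈(gapPos κ m : ℝ) / (τ - 1)⌉₊ with hj
  have hj1 : (gapPos κ m : ℝ) ≤ (τ - 1) * j := by
    rw [mul_comm, ← div_le_iff₀ hτ1]
    exact Nat.le_ceil _
  have hj2 : (j : ℝ) ≤ (T * T + κ * T) / (τ - 1) + 1 := by
    refine (Nat.ceil_lt_add_one (by positivity)).le.trans ?_
    gcongr
  refine ⟨j, ?_, m, Nat.le_floor hj1, ?_⟩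
  · have h1 : (τ - 1) * J < (τ - 1) * j := by
      have h2 := (le_max_right _ _).trans_lt hk
      nlinarith
    exact_mod_cast (lt_of_mul_lt_mul_left h1 hτ1.le).le
  · have h1 : (⌊(τ - 1) * j⌋₊ : ℝ) ≤ (τ - 1) * j := Nat.floor_le (by positivity)
    have h2 : τ * j ≤ τ * ((T * T + κ * T) / (τ - 1) + 1) := by gcongr
    have h3 : τ * ((T * T + κ * T) / (τ - 1) + 1) = T * T + (κ - δ) * (T * T) + B * T + τ := by
      rw [hB, hδdef]
      field_simp
      ring
    have h4 : B + (τ + 5) < δ * T := by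
      have h5 := ((le_max_left _ _).trans_lt hk).trans hkT
      rwa [div_lt_iff₀ hδ, mul_comm] at h5
    have h5 : (B + (τ + 5)) * T < δ * T * T := by gcongr
    have h6 : (τ + 5) * 1 ≤ (τ + 5) * T := by
      gcongr
      linarith
    have h7 : ((⌊(τ - 1) * j⌋₊ + (j + 5) : ℕ) : ℝ) < gapPos κ (m + 1) := by
      push_cast
      linarith
    exact_mod_cast h7

/-! ### The sequence -/

/-- The sequence whose value at `n` with `2 ^ j ≤ n < 2 ^ (j + 1)` is `n * 2 ^ ⌊(τ - 1) * j⌋`: on each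
dyadic block, an arithmetic progression of multiples of a single power of two. -/
noncomputable def blockSeq (τ : ℝ) (n : ℕ) : ℕ := n * 2 ^ ⌊(τ - 1) * (Nat.log 2 n : ℕ)⌋₊

lemma strictMono_blockSeq {τ : ℝ} (hτ : 1 ≤ τ) : StrictMono (blockSeq τ) := fun m n h => by
  have h1 : ⌊(τ - 1) * (Nat.log 2 m : ℕ)⌋₊ ≤ ⌊(τ - 1) * (Nat.log 2 n : ℕ)⌋₊ := by
    have h2 : (Nat.log 2 m : ℝ) ≤ (Nat.log 2 n : ℕ) := by exact_mod_cast Nat.log_mono_right h.le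
    have h3 : 0 ≤ τ - 1 := by linarith
    gcongr
  exact Nat.mul_lt_mul_of_lt_of_le h (Nat.pow_le_pow_right (by norm_num) h1) (by positivity)

lemma blockSeq_le {τ : ℝ} (hτ : 1 ≤ τ) (n : ℕ) : (blockSeq τ n : ℝ) ≤ (n : ℝ) ^ τ := by
  rcases Nat.eq_zero_or_pos n with rfl | hn
  · simp [blockSeq, Real.zero_rpow (by linarith : τ ≠ 0)]
  have hτ0 : 0 ≤ τ - 1 := by linarith
  have hn' : (0 : ℝ) < n := by exact_mod_cast hn
  have h1 : (2 : ℝ) ^ ⌊(τ - 1) * (Nat.log 2 n : ℕ)⌋₊ ≤ (n : ℝ) ^ (τ - 1) := by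
    calc (2 : ℝ) ^ ⌊(τ - 1) * (Nat.log 2 n : ℕ)⌋₊
        = (2 : ℝ) ^ (⌊(τ - 1) * (Nat.log 2 n : ℕ)⌋₊ : ℝ) := (Real.rpow_natCast _ _).symm
      _ ≤ 2 ^ ((τ - 1) * (Nat.log 2 n : ℕ)) :=
          Real.rpow_le_rpow_of_exponent_le (by norm_num) (Nat.floor_le (by positivity))
      _ = ((2 : ℝ) ^ Nat.log 2 n) ^ (τ - 1) := by
          rw [mul_comm, Real.rpow_mul (by norm_num), Real.rpow_natCast]
      _ ≤ (n : ℝ) ^ (τ - 1) := by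
          gcongr
          exact_mod_cast Nat.pow_log_le_self 2 hn.ne'
  unfold blockSeq
  push_cast
  calc (n : ℝ) * 2 ^ ⌊(τ - 1) * (Nat.log 2 n : ℕ)⌋₊ ≤ n * (n : ℝ) ^ (τ - 1) := by gcongr
    _ = (n : ℝ) ^ τ := by
      rw [Real.rpow_sub_one hn'.ne']
      field_simp

/-- If `2 ^ ⌊(τ - 1) * j⌋ * x` is close to an integer, the terms of the exponential sum with
`2 ^ j ≤ n < 2 ^ (j + 1)` are all close to `1`. -/
lemma norm_sum_block_ge {τ x : ℝ} {j : ℕ} {k : ℤ}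
    (h : |2 ^ ⌊(τ - 1) * (j : ℝ)⌋₊ * x - k| ≤ (1 / 2) ^ (j + 5)) :
    (2 : ℝ) ^ j / 2
      ≤ ‖∑ n ∈ Finset.Ioc (2 ^ j - 1) (2 ^ (j + 1) - 1), expTwoPiI (x * (blockSeq τ n : ℝ))‖ := by
  set I := Finset.Ioc (2 ^ j - 1) (2 ^ (j + 1) - 1) with hI
  have hpos : 0 < 2 ^ j := by positivity
  have hsucc : 2 ^ (j + 1) = 2 * 2 ^ j := by ring
  have hcard : (I.card : ℝ) = 2 ^ j := by
    have : I.card = 2 ^ j := by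
      rw [hI, Nat.card_Ioc]
      omega
    exact_mod_cast this
  have hterm : ∀ n ∈ I, ‖expTwoPiI (x * (blockSeq τ n : ℝ)) - 1‖ ≤ 1 / 2 := by
    intro n hn
    rw [hI, Finset.mem_Ioc] at hn
    have hlog : Nat.log 2 n = j :=
      Nat.log_eq_of_pow_le_of_lt_pow (by omega) (by omega)
    set a := ⌊(τ - 1) * (j : ℝ)⌋₊ with ha
    have h1 : x * (blockSeq τ n : ℝ) = (n : ℝ) * (2 ^ a * x - k) + ((n * k : ℤ) : ℝ) := by
      unfold blockSeq
      rw [hlog, ← ha]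
      push_cast
      ring
    rw [h1, expTwoPiI_add, expTwoPiI_intCast, mul_one]
    refine (norm_expTwoPiI_sub_one_le _).trans ?_
    have h2 : (n : ℝ) ≤ 2 * 2 ^ j := by
      have : n ≤ 2 * 2 ^ j := by omega
      exact_mod_cast this
    have h3 : (2 : ℝ) ^ j * (1 / 2) ^ j = 1 := by
      rw [← mul_pow]
      norm_num
    have hpi := Real.pi_pos
    have hpi4 := Real.pi_le_four
    rw [abs_mul, Nat.abs_cast]
    calc 2 * Real.pi * ((n : ℝ) * |2 ^ a * x - k|)
        ≤ 2 * Real.pi * (2 * 2 ^ j * (1 / 2) ^ (j + 5)) := by gcongr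
      _ = Real.pi / 8 * ((2 : ℝ) ^ j * (1 / 2) ^ j) := by ring
      _ ≤ 1 / 2 := by
        rw [h3]
        linarith
  have h1 : ‖∑ n ∈ I, (expTwoPiI (x * (blockSeq τ n : ℝ)) - 1)‖ ≤ 2 ^ j / 2 := by
    refine (norm_sum_le_of_le _ hterm).trans_eq ?_
    rw [Finset.sum_const, nsmul_eq_mul, hcard]
    ring
  rw [Finset.sum_sub_distrib, Finset.sum_const, nsmul_eq_mul, mul_one] at h1
  have h2 := norm_sub_norm_le (I.card : ℂ) (∑ n ∈ I, expTwoPiI (x * (blockSeq τ n : ℝ)))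
  rw [norm_sub_rev, Complex.norm_natCast, hcard] at h2
  linarith

/-- Infinitely many blocks with a large contribution make infinitely many sums large: the sum is
large at one of the two ends of each such block. -/
lemma mem_veryLargeSumSet_blockSeq {τ x : ℝ} (hx : x ∈ Set.Icc (0 : ℝ) 1)
    (h : ∀ J : ℕ, ∃ j ≥ J, ∃ k : ℤ, |2 ^ ⌊(τ - 1) * (j : ℝ)⌋₊ * x - k| ≤ (1 / 2) ^ (j + 5)) :
    x ∈ veryLargeSumSet (fun n => (blockSeq τ n : ℝ)) (1 / 8) := by
  refine ⟨hx, Set.infinite_of_forall_exists_gt fun L => ?_⟩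
  obtain ⟨j, hj, k, hk⟩ := h (L + 1)
  have hjlt : j < 2 ^ j := Nat.lt_two_pow_self
  have hsucc : 2 ^ (j + 1) = 2 * 2 ^ j := by ring
  have h1 := norm_sum_block_ge hk
  have h2 := expSum_eq_add_sum_Ioc (fun n => (blockSeq τ n : ℝ)) x
    (show 2 ^ j - 1 ≤ 2 ^ (j + 1) - 1 by omega)
  rw [← sub_eq_iff_eq_add'] at h2
  rw [← h2] at h1
  have h3 := h1.trans (norm_sub_le _ _)
  have hpos : (0 : ℝ) < 2 ^ j := by positivity
  rcases le_total ((2 : ℝ) ^ j / 4)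
    ‖expSum (fun n => (blockSeq τ n : ℝ)) x (2 ^ j - 1)‖ with h4 | h4
  · refine ⟨2 ^ j - 1, ?_, by omega⟩
    have h5 : ((2 ^ j - 1 : ℕ) : ℝ) ≤ 2 ^ j := by exact_mod_cast Nat.sub_le _ _
    simp only [Set.mem_ofPred_eq]
    linarith
  · refine ⟨2 ^ (j + 1) - 1, ?_, by omega⟩
    have h5 : ((2 ^ (j + 1) - 1 : ℕ) : ℝ) ≤ 2 * 2 ^ j := by
      have : 2 ^ (j + 1) - 1 ≤ 2 * 2 ^ j := by omega
      exact_mod_cast this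
    simp only [Set.mem_ofPred_eq]
    linarith

lemma le_dimH_veryLargeSumSet_blockSeq {τ : ℝ} (hτ : 1 < τ) :
    ENNReal.ofReal (1 - 1 / τ)
      ≤ dimH (veryLargeSumSet (fun n => (blockSeq τ n : ℝ)) (1 / 8)) := by
  have hτ1 : 0 < τ - 1 := by linarith
  have hlow : ∀ κ : ℝ, 1 / (τ - 1) < κ → ENNReal.ofReal (1 / (1 + κ))
      ≤ dimH (veryLargeSumSet (fun n => (blockSeq τ n : ℝ)) (1 / 8)) := by
    intro κ hκ
    have hκ0 : 0 < κ := lt_trans (by positivity) hκ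
    have hp := strictMono_gapPos hκ0.le
    refine (le_dimH_image_spread hp (by positivity) (gapPos_le hκ0.le)).trans (dimH_mono ?_)
    rintro _ ⟨y, -, rfl⟩
    refine mem_veryLargeSumSet_blockSeq (spread_mem_Icc hp y) fun J => ?_
    obtain ⟨j, hj, m, h1, h2⟩ := exists_window_in_gap hτ hκ J
    exact ⟨j, hj, exists_int_abs_two_pow_mul_spread_sub_le hp y h1 h2⟩
  have hval : 1 - 1 / τ = 1 / (1 + 1 / (τ - 1)) := by
    have : τ ≠ 0 := by linarith
    field_simp
    ring
  have hcont : ContinuousAt (fun κ : ℝ => 1 / (1 + κ)) (1 / (τ - 1)) :=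
    continuousAt_const.div (by fun_prop) (by positivity)
  have hlim : Tendsto (fun κ : ℝ => ENNReal.ofReal (1 / (1 + κ))) (𝓝[>] (1 / (τ - 1)))
      (𝓝 (ENNReal.ofReal (1 - 1 / τ))) := by
    rw [hval]
    exact (ENNReal.tendsto_ofReal hcont).mono_left nhdsWithin_le_nhds
  exact le_of_tendsto hlim (by filter_upwards [self_mem_nhdsWithin] with κ hκ using hlow κ hκ)

theorem theorem3p8 (τ : ℝ) (hτ : 1 ≤ τ) :
    ∃ f : ℕ → ℕ, StrictMono f ∧
      (fun n : ℕ => (f n : ℝ)) =O[Filter.atTop] (fun n : ℕ => (n : ℝ) ^ τ) ∧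
      ∃ c : ℝ, 0 < c ∧
        dimH (veryLargeSumSet (fun n => (f n : ℝ)) c) = ENNReal.ofReal (1 - 1 / τ) := by
  refine ⟨blockSeq τ, strictMono_blockSeq hτ, ?_, 1 / 8, by norm_num, le_antisymm ?_ ?_⟩
  · refine Asymptotics.IsBigO.of_bound 1 (Eventually.of_forall fun n => ?_)
    rw [one_mul, Real.norm_of_nonneg (by positivity), Real.norm_of_nonneg (by positivity)]
    exact blockSeq_le hτ n
  · exact dimH_veryLargeSumSet_le (strictMono_blockSeq hτ) hτ zero_le_one
      (fun n => by rw [one_mul]; exact blockSeq_le hτ n) (by norm_num)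
  · rcases hτ.eq_or_lt with rfl | h
    · simp
    · exact le_dimH_veryLargeSumSet_blockSeq h
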